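/- All graphs are finite and simple. A clique-coloring of a graph $G$ is a map from $V(G)$ to a set of colors such that no inclusion-wise maximal clique of $G$ with at least two vertices is monochromatic; an $m$-clique-coloring is a clique-coloring with values in $\{1,\dots,m\}$ (not every color has to be used). The clique-chromatic number $\chi_C(G)$ is the least $m$ such that $G$ has an $m$-clique-coloring. For integers $n\ge r\ge 1$ put $N=\binom{n}{r}$. The universal $(n,r)$-expansion of a graph $G$ is obtained from $G$ as follows: for every $N$-vertex clique $C$ of $G$ and every bijection $\phi$ from $C$ to the set of $r$-element subsets of $\{1,\dots,n\}$, add a new clique $X_C^{\phi}=\{x_1^{\phi},\dots,x_n^{\phi}\}$ on $n$ vertices, with $c\in C$ adjacent to $x_j^{\phi}$ if and only if $j\in\phi(c)$; there are no edges between $X_C^{\phi}$ and $V(G)\setminus C$, and the new cliques are pairwise anti-complete to each other. Let $k\ge 2$ be an integer. Put $n_k=(k+1)!$ and $n_{i-1}=\binom{n_i^2}{n_i}$ for $i=k,k-1,\dots,1$. Let $H_0$ be a complete graph on $(k+1)n_0$ vertices, for each $i\in\{1,\dots,k\}$ let $H_i$ be the universal $(n_i^2,n_i)$-expansion of $H_{i-1}$,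 and let $G_k=H_k$; thus $H_0,\dots,H_k$ are induced subgraphs of $G_k$. Then for every $(k+1)$-clique-coloring of $G_k$ and every $i\in\{0,\dots,k\}$, the graph $H_i$ contains a clique with exactly $n_i$ vertices on which exactly $i+1$ colors of the given coloring of $G_k$ appear, each of them on exactly $\frac{n_i}{i+1}$ vertices of the clique (in particular, $i+1$ divides $n_i$). Consequently every $(k+1)$-clique-coloring of $G_k$ uses all $k+1$ colors, and $\chi_C(G_k)\ge k+1$. -/

import Mathlib

namespace SimpleGraph

/-- A clique-coloring of `G`: no inclusion-wise maximal clique with at least two vertices is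
monochromatic. -/
def IsCliqueColoring {V α : Type*} (G : SimpleGraph V) (φ : V → α) : Prop :=
  ∀ s : Set V, Maximal G.IsClique s → s.Nontrivial → ¬ ∃ a : α, ∀ v ∈ s, φ v = a

/-- `G` is `m`-clique-colorable: it has a clique-coloring with colors in an `m`-element set. -/
def CliqueColorable {V : Type*} (G : SimpleGraph V) (m : ℕ) : Prop :=
  ∃ φ : V → Fin m, G.IsCliqueColoring φ

/-- The clique-chromatic number: the least `m` such that `G` is `m`-clique-colorable
(`⊤` if there is none, which cannot happen for a finite graph). -/
noncomputable def cliqueChromaticNumber {V : Type*} (G : SimpleGraph V) : ℕ∞ :=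
  ⨅ m ∈ {m : ℕ | G.CliqueColorable m}, (m : ℕ∞)

end SimpleGraph

namespace CliqueExpansion

/-- The index of one attached clique of the universal `(n, r)`-expansion of `G`: an `N`-vertex
clique `C` of `G`, where `N = n.choose r`, together with a bijection from `C` to the set of
`r`-element subsets of an `n`-element set. -/
structure PetalIndex {V : Type*} (G : SimpleGraph V) (n r : ℕ) where
  /-- The clique at which the expansion is performed. -/
  C : Finset V
  isNClique : G.IsNClique (n.choose r) C
  /-- The bijection giving the neighborhoods of the vertices of `C` in the attached clique. -/
  bij : {c : V // c ∈ C} ≃ {A : Finset (Fin n) // A.card = r}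

/-- The vertices of the universal `(n, r)`-expansion of `G`: those of `G`, and for each petal `p`
the `n` vertices `(p, j)` of the clique attached for `p`. -/
abbrev ExpansionVertex {V : Type*} (G : SimpleGraph V) (n r : ℕ) :=
  V ⊕ (PetalIndex G n r × Fin n)

/-- Adjacency in the universal `(n, r)`-expansion. -/
def expansionAdj {V : Type*} (G : SimpleGraph V) (n r : ℕ) :
    ExpansionVertex G n r → ExpansionVertex G n r → Prop
  | .inl u, .inl v => G.Adj u v
  | .inl u, .inr (p, j) => ∃ h : u ∈ p.C, j ∈ (p.bij ⟨u, h⟩).1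
  | .inr (p, j), .inl u => ∃ h : u ∈ p.C, j ∈ (p.bij ⟨u, h⟩).1
  | .inr (p, i), .inr (q, j) => p = q ∧ i ≠ j

/-- The universal `(n, r)`-expansion of `G`: the `(n, r)`-expansion of `G` is performed at every
clique of `G` with `n.choose r` vertices. -/
def universalExpansion {V : Type*} (G : SimpleGraph V) (n r : ℕ) :
    SimpleGraph (ExpansionVertex G n r) where
  Adj := expansionAdj G n r
  symm := by
    constructor
    rintro (u | ⟨p, i⟩) (v | ⟨q, j⟩) h
    · exact SimpleGraph.Adj.symm (G := G) h
    · exact h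
    · exact h
    · exact ⟨h.1.symm, h.2.symm⟩
  loopless := by
    constructor
    rintro (u | ⟨p, i⟩) h
    · exact G.loopless.irrefl u h
    · exact h.2 rfl

/-- The canonical inclusion: `G` is an induced subgraph of its universal expansion. -/
def baseEmbedding {V : Type*} (G : SimpleGraph V) (n r : ℕ) :
    G ↪g universalExpansion G n r where
  toFun := Sum.inl
  inj' := Sum.inl_injective
  map_rel_iff' := Iff.rfl

/-- The numbers `n_k, n_{k-1}, …, n_0` in this (increasing) order:
`revSize k j` is `n_{k-j}`. -/
def revSize (k : ℕ) : ℕ → ℕ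
  | 0 => (k + 1).factorial
  | j + 1 => (revSize k j ^ 2).choose (revSize k j)

/-- The number `n_i`, for `0 ≤ i ≤ k`. -/
def size (k i : ℕ) : ℕ := revSize k (k - i)

theorem size_self (k : ℕ) : size k k = (k + 1).factorial := by
  simp [size, revSize]

theorem size_pred (k i : ℕ) (hi : i < k) :
    size k i = (size k (i + 1) ^ 2).choose (size k (i + 1)) := by
  unfold size
  obtain ⟨d, rfl⟩ : ∃ d, k = i + 1 + d := ⟨k - (i + 1), by omega⟩
  have h1 : i + 1 + d - i = d + 1 := by omega
  have h2 : i + 1 + d - (i + 1) = d := by omega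
  rw [h1, h2, revSize]

/-- The graphs `H_0, H_1, …` with their vertex types: `H_0` is complete on `(k + 1) n_0` vertices,
and `H_{i+1}` is the universal `(n_{i+1}^2, n_{i+1})`-expansion of `H_i`. -/
def tower (k : ℕ) : ℕ → (V : Type) × SimpleGraph V
  | 0 => ⟨Fin ((k + 1) * size k 0), ⊤⟩
  | i + 1 => ⟨_, universalExpansion (tower k i).2 (size k (i + 1) ^ 2) (size k (i + 1))⟩

/-- The vertices of `H_i`. -/
abbrev Vert (k i : ℕ) : Type := (tower k i).1

/-- The graph `H_i`, for `0 ≤ i ≤ k`. -/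
abbrev H (k i : ℕ) : SimpleGraph (Vert k i) := (tower k i).2

/-- The graph `G_k = H_k`. -/
abbrev Gk (k : ℕ) : SimpleGraph (Vert k k) := H k k

/-- The canonical inclusion of `H_i` in `H_{i+1}`. -/
def stepEmbedding (k i : ℕ) : H k i ↪g H k (i + 1) :=
  baseEmbedding (H k i) (size k (i + 1) ^ 2) (size k (i + 1))

/-- The canonical inclusion of `H_i` in `H_j` as an induced subgraph, for `i ≤ j`. -/
def incl (k : ℕ) {i j : ℕ} (h : i ≤ j) : H k i ↪g H k j :=
  Nat.leRec (motive := fun j _ => H k i ↪g H k j) SimpleGraph.Embedding.refl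
    (fun j _ f => (stepEmbedding k j).comp f) h

/-- `C` is an `(i+1)`-uniform clique of `H_i` for a coloring `φ` of `G_k`: it is a clique of `H_i`
with `n_i` vertices on which exactly `i + 1` colors appear, each on exactly `n_i / (i + 1)`
vertices. -/
structure IsUniformClique {k i : ℕ} (hi : i ≤ k) (φ : Vert k k → Fin (k + 1))
    (C : Finset (Vert k i)) : Prop where
  isNClique : (H k i).IsNClique (size k i) C
  card_colors : (C.image fun v => φ (incl k hi v)).card = i + 1
  card_class : ∀ a ∈ C.image (fun v => φ (incl k hi v)),
    (i + 1) * (C.filter fun v => φ (incl k hi v) = a).card = size k i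

end CliqueExpansion

/-! Induct on `i`: a balanced clique `C` of `H_i` with `p` colors yields one of `H_{i+1}` with `p +
1` (`exists_balanced_clique_succ`). Put `r = n_{i+1}`, so `C` is in bijection with the `r`-subsets
of an `r ^ 2`-set. A random bijection makes every color class of `C` meet every wide interval `[J,
D]` of `r`-subsets (`exists_equiv_forall_between`); universality provides a petal for it.

If a color of `C` had `2 * r` petal vertices, some vertex of `C` with that color would have all its
petal neighbors in it, giving a monochromatic star. The star is a maximal clique with `r + 1`
vertices and stays maximal up to `G_k` (`maximal_image_incl`), a contradiction. Hence a color used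
on at least `2 * r` petal vertices, which exists by pigeonhole, is new. Take `r / (p + 1)` of its
vertices as `J`; each old class has that many vertices complete to `J` (`le_card_filter_superset`),
and together these form the next clique. -/

/-! ### Spreading equal color classes by random column shifts. -/

/-- Union bound over pairs `(i, a)`. A uniform `g` fails for `(i, a)` when each `g b` avoids as many
values as `Q i` has points in column `b`; by independence and `1 - x ≤ exp (-x)` this has
probability at most `exp (-q / |G|)`. -/
theorem exists_shift_forall_hits {G B ι : Type*} [AddCommGroup G] [Fintype G] [Fintype B]
    [DecidableEq G] [DecidableEq B] (I : Finset ι) (Q : ι → Finset (G × B)) (q : ℕ)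
    (hQ : ∀ i ∈ I, q ≤ (Q i).card)
    (hlt : (I.card * Fintype.card G : ℝ) * Real.exp (-(q / Fintype.card G)) < 1) :
    ∃ g : B → G, ∀ i ∈ I, ∀ a : G, ∃ z ∈ Q i, z.1 = a + g z.2 := by
  classical
  by_contra! hcon
  have hp : (0 : ℝ) < Fintype.card G := by exact_mod_cast Fintype.card_pos
  let hit : ι → G → B → Finset G := fun i a b =>
    ((Q i).filter (fun z => z.2 = b)).image (fun z => z.1 - a)
  let bad : ι × G → Finset (B → G) := fun ia => Fintype.piFinset fun b => (hit ia.1 ia.2 b)ᶜ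
  have hcover : (Finset.univ : Finset (B → G)) ⊆ (I ×ˢ Finset.univ).biUnion bad := by
    intro g _
    obtain ⟨i, hi, a, h⟩ := hcon g
    simp only [Finset.mem_biUnion, Finset.mem_product, Finset.mem_univ, and_true]
    refine ⟨(i, a), hi, ?_⟩
    simp only [bad, hit, Fintype.mem_piFinset, Finset.mem_compl, Finset.mem_image,
      Finset.mem_filter, not_exists, not_and, and_imp]
    rintro b z hz rfl hza
    exact h z hz (by rw [← hza]; abel)
  have hbad : ∀ ia ∈ I ×ˢ (Finset.univ : Finset G), ((bad ia).card : ℝ) ≤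
      (Fintype.card G : ℝ) ^ Fintype.card B * Real.exp (-(q / Fintype.card G)) := by
    rintro ⟨i, a⟩ hia
    have hi : i ∈ I := by simpa using hia
    have hcard : ∀ b, (hit i a b).card = ((Q i).filter (fun z => z.2 = b)).card := by
      intro b
      apply Finset.card_image_of_injOn
      rintro ⟨x, y⟩ hz ⟨x', y'⟩ hz' h
      simp only [Finset.coe_filter, Set.mem_ofPred_eq] at hz hz'
      simp only [sub_left_inj] at h
      rw [h, hz.2, hz'.2]
    have hsum : ∑ b, (hit i a b).card = (Q i).card := by
      simp_rw [hcard]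
      exact (Finset.card_eq_sum_card_fiberwise (fun _ _ => Finset.mem_univ _)).symm
    simp only [bad, Fintype.card_piFinset, Nat.cast_prod]
    calc ∏ b, (((hit i a b)ᶜ.card : ℕ) : ℝ)
        ≤ ∏ b, ((Fintype.card G : ℝ) * Real.exp (-((hit i a b).card / Fintype.card G))) := by
          apply Finset.prod_le_prod
          · intros; positivity
          · intro b _
            rw [Finset.card_compl, Nat.cast_sub (Finset.card_le_univ _)]
            have h := Real.one_sub_le_exp_neg ((hit i a b).card / Fintype.card G : ℝ)
            calc (Fintype.card G : ℝ) - (hit i a b).card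
                = Fintype.card G * (1 - (hit i a b).card / Fintype.card G) := by field_simp
              _ ≤ _ := by gcongr
      _ = (Fintype.card G : ℝ) ^ Fintype.card B * Real.exp (-((Q i).card / Fintype.card G)) := by
          rw [Finset.prod_mul_distrib, ← Real.exp_sum, Finset.prod_const, Finset.card_univ,
            Finset.sum_neg_distrib, ← Finset.sum_div, ← hsum, Nat.cast_sum]
      _ ≤ _ := by
          gcongr
          exact hQ i hi
  have h1 : ((Fintype.card G : ℝ)) ^ Fintype.card B ≤
      (I.card * Fintype.card G : ℝ) *
        ((Fintype.card G : ℝ) ^ Fintype.card B * Real.exp (-(q / Fintype.card G))) := by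
    have h2 := (Finset.card_le_card hcover).trans Finset.card_biUnion_le
    have h3 := Finset.sum_le_card_nsmul _ _ _ hbad
    rw [Finset.card_univ, Fintype.card_fun] at h2
    have h4 : ((Fintype.card G : ℝ)) ^ Fintype.card B ≤
      ∑ ia ∈ I ×ˢ (Finset.univ : Finset G), ((bad ia).card : ℝ) := by exact_mod_cast h2
    refine h4.trans (h3.trans (le_of_eq ?_))
    simp [Finset.card_product]
  have h5 : (0 : ℝ) < (Fintype.card G : ℝ) ^ Fintype.card B := by positivity
  nlinarith

theorem exists_equiv_forall_fiber_hits {C T P ι : Type*} [Fintype C] [Fintype T] [Fintype P]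
    [DecidableEq P] (f : C → P) (s : ℕ)
    (hf : ∀ a, Fintype.card {c // f c = a} = s) (hT : Fintype.card C = Fintype.card T)
    (I : Finset ι) (Q : ι → Finset T) (q : ℕ) (hQ : ∀ i ∈ I, q ≤ (Q i).card)
    (hlt : (I.card * Fintype.card P : ℝ) * Real.exp (-(q / Fintype.card P)) < 1) :
    ∃ e : C ≃ T, ∀ i ∈ I, ∀ a, ∃ c, f c = a ∧ e c ∈ Q i := by
  classical
  rcases isEmpty_or_nonempty P with hP | hP
  · exact ⟨Fintype.equivOfCardEq hT, fun _ _ a => (hP.false a).elim⟩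
  have : NeZero (Fintype.card P) := ⟨Fintype.card_ne_zero⟩
  let eP : P ≃ Fin (Fintype.card P) := Fintype.equivFin P
  -- View `C` as a grid whose rows are the fibers of `f`. Shifting each column cyclically is a
  -- permutation, so the result is a bijection for every `g`.
  let eC : C ≃ P × Fin s := (Equiv.sigmaFiberEquiv f).symm.trans
    ((Equiv.sigmaCongrRight fun a => Fintype.equivFinOfCardEq (hf a)).trans
      (Equiv.sigmaEquivProd P (Fin s)))
  have heC : ∀ c, (eC c).1 = f c := fun c => rfl
  let eC' : C ≃ Fin (Fintype.card P) × Fin s := eC.trans (eP.prodCongr (Equiv.refl _))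
  let eT : T ≃ Fin (Fintype.card P) × Fin s := (Fintype.equivOfCardEq hT).symm.trans eC'
  obtain ⟨g, hg⟩ := exists_shift_forall_hits I (fun i => (Q i).map eT.toEmbedding) q
    (fun i hi => by simpa using hQ i hi) (by simpa using hlt)
  let sh : Fin (Fintype.card P) × Fin s ≃ Fin (Fintype.card P) × Fin s :=
    { toFun := fun z => (z.1 + g z.2, z.2)
      invFun := fun z => (z.1 - g z.2, z.2)
      left_inv := fun z => by simp
      right_inv := fun z => by simp }
  refine ⟨eC'.trans (sh.trans eT.symm), fun i hi a => ?_⟩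
  obtain ⟨z, hz, hza⟩ := hg i hi (eP a)
  obtain ⟨A, hA, rfl⟩ := Finset.mem_map.1 hz
  refine ⟨eC.symm (a, (eT A).2), ?_, ?_⟩
  · rw [← heC, Equiv.apply_symm_apply]
  · have : sh (eC' (eC.symm (a, (eT A).2))) = eT A := by
      simp only [eC', sh, Equiv.trans_apply, Equiv.apply_symm_apply, Equiv.coe_fn_mk]
      exact Prod.ext hza.symm rfl
    simpa only [Equiv.trans_apply, this, Equiv.symm_apply_apply] using hA

/-! ### Estimates for the union bound over intervals of `r`-subsets. -/

/-- `m * p < 4 ^ (r ^ 2) * 2 ^ p = 2 ^ (2 * r ^ 2 + p) ≤ exp (q / p)`, using `2 ≤ e`. There are `4 ^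
(r ^ 2)` pairs `(J, D)`. -/
theorem card_mul_exp_neg_lt_one {r p q m : ℕ} (hp : 0 < p) (hm : m ≤ 4 ^ (r ^ 2))
    (hq : p * (2 * r ^ 2 + p) ≤ q) : (m * p : ℝ) * Real.exp (-(q / p)) < 1 := by
  have hp' : (0 : ℝ) < p := by exact_mod_cast hp
  have h1 : ((2 * r ^ 2 + p : ℕ) : ℝ) ≤ q / p := by
    rw [le_div_iff₀ hp', mul_comm]
    exact_mod_cast hq
  have h2 : (2 : ℝ) ^ (2 * r ^ 2 + p) ≤ Real.exp (q / p) := by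
    calc (2 : ℝ) ^ (2 * r ^ 2 + p) ≤ (Real.exp 1) ^ (2 * r ^ 2 + p) := by
          gcongr
          linarith [Real.add_one_le_exp (1 : ℝ)]
      _ = Real.exp ((2 * r ^ 2 + p : ℕ) : ℝ) := by rw [← Real.exp_nat_mul, mul_one]
      _ ≤ _ := Real.exp_le_exp.2 h1
  have h3 : (m * p : ℝ) < 2 ^ (2 * r ^ 2 + p) := by
    have : m * p < 2 ^ (2 * r ^ 2 + p) := by
      rw [pow_add, pow_mul]
      calc m * p ≤ 4 ^ r ^ 2 * p := Nat.mul_le_mul_right _ hm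
        _ < _ := by
          norm_num only
          exact Nat.mul_lt_mul_of_pos_left Nat.lt_two_pow_self (by positivity)
    exact_mod_cast this
  rw [Real.exp_neg, ← div_eq_mul_inv, div_lt_one (Real.exp_pos _)]
  linarith

/-- The leading terms are at most `2 r³ / 3` on the left and `4 r³ / 3` on the right. -/
theorem mul_le_choose_two_mul_three {r p : ℕ} (hr : 6 ≤ r) (hp : 3 * p ≤ r) :
    p * (2 * r ^ 2 + p) ≤ (2 * r).choose 3 := by
  have h : 6 * (2 * r).choose 3 = 2 * r * (2 * r - 1) * (2 * r - 2) := by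
    have := Nat.descFactorial_eq_factorial_mul_choose (2 * r) 3
    simp only [Nat.descFactorial, Nat.factorial] at this
    norm_num at this
    rw [← this]; ring
  obtain ⟨t, rfl⟩ := Nat.exists_eq_add_of_le hr
  have e1 : 2 * (6 + t) - 1 = 11 + 2 * t := by omega
  have e2 : 2 * (6 + t) - 2 = 10 + 2 * t := by omega
  rw [e1, e2] at h
  have h3 : 9 * (p * (2 * (6 + t) ^ 2 + p)) ≤ (6 + t) * (6 * (6 + t) ^ 2 + (6 + t)) := by
    calc 9 * (p * (2 * (6 + t) ^ 2 + p)) = (3 * p) * (6 * (6 + t) ^ 2 + 3 * p) := by ring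
      _ ≤ _ := by gcongr
  nlinarith [sq_nonneg (t : ℤ), Nat.zero_le (t ^ 3), Nat.zero_le (t ^ 2)]

theorem choose_le_choose_of_le_half {n a b : ℕ} (hab : a ≤ b) (hb : 2 * b ≤ n) :
    n.choose a ≤ n.choose b := by
  induction b, hab using Nat.le_induction with
  | base => exact le_rfl
  | succ b _ ih =>
    exact (ih (by omega)).trans (Nat.choose_le_succ_of_lt_half_left (by omega))

/-- Removing `J` leaves the `(r - |J|)`-subsets of `D \ J`, a set with at least `2 * r` elements; as
`3 ≤ r - |J| ≤ r`, the binomial coefficient is at least the one at 3. -/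
theorem choose_le_card_between {n r : ℕ} {J D : Finset (Fin n)} (hJD : J ⊆ D)
    (hD : 2 * r + J.card ≤ D.card) (hJ : J.card + 3 ≤ r) :
    (2 * r).choose 3 ≤ (Finset.univ.filter
      fun A : {A : Finset (Fin n) // A.card = r} => J ⊆ A.1 ∧ A.1 ⊆ D).card := by
  calc (2 * r).choose 3 ≤ (2 * r).choose (r - J.card) :=
        choose_le_choose_of_le_half (by omega) (by omega)
    _ ≤ (D \ J).card.choose (r - J.card) := by
        apply Nat.choose_le_choose
        rw [Finset.card_sdiff_of_subset hJD]
        omega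
    _ = ((D \ J).powersetCard (r - J.card)).card := (Finset.card_powersetCard _ _).symm
    _ ≤ ((Finset.univ.filter
      fun A : {A : Finset (Fin n) // A.card = r} => J ⊆ A.1 ∧ A.1 ⊆ D).image
        (fun A => A.1 \ J)).card := by
        apply Finset.card_le_card
        intro B hB
        rw [Finset.mem_powersetCard] at hB
        have hdis : Disjoint J B :=
          Finset.disjoint_left.2 fun x hx hx' => (Finset.mem_sdiff.1 (hB.1 hx')).2 hx
        simp only [Finset.mem_image, Finset.mem_filter, Finset.mem_univ, true_and]
        refine ⟨⟨J ∪ B, ?_⟩, ⟨Finset.subset_union_left, ?_⟩, ?_⟩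
        · rw [Finset.card_union_of_disjoint hdis]
          omega
        · exact Finset.union_subset hJD (hB.1.trans Finset.sdiff_subset)
        · exact Finset.union_sdiff_cancel_left hdis
    _ ≤ _ := Finset.card_image_le

/-- Balanced classes can be spread over the `r`-subsets of an `r ^ 2`-element set so that each
class meets every sufficiently wide interval of subsets. -/
theorem exists_equiv_forall_between {C P : Type*} [Fintype C] [Fintype P]
    [DecidableEq P] [Nonempty P] {r : ℕ} (f : C → P) (s : ℕ)
    (hf : ∀ a, Fintype.card {c // f c = a} = s) (hC : Fintype.card C = (r ^ 2).choose r)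
    (hr : 6 ≤ r) (hp : 3 * Fintype.card P ≤ r) :
    ∃ e : C ≃ {A : Finset (Fin (r ^ 2)) // A.card = r}, ∀ J D : Finset (Fin (r ^ 2)),
      J ⊆ D → 2 * r + J.card ≤ D.card → J.card + 3 ≤ r →
      ∀ a, ∃ c, f c = a ∧ J ⊆ (e c).1 ∧ (e c).1 ⊆ D := by
  classical
  let I : Finset (Finset (Fin (r ^ 2)) × Finset (Fin (r ^ 2))) :=
    Finset.univ.filter fun x => x.1 ⊆ x.2 ∧ 2 * r + x.1.card ≤ x.2.card ∧ x.1.card + 3 ≤ r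
  have hI : I.card ≤ 4 ^ (r ^ 2) := by
    refine (Finset.card_le_univ _).trans (le_of_eq ?_)
    simp [← mul_pow]
  obtain ⟨e, he⟩ := exists_equiv_forall_fiber_hits
    (T := {A : Finset (Fin (r ^ 2)) // A.card = r}) f s hf (by simp [hC]) I
    (fun x => Finset.univ.filter fun A => x.1 ⊆ A.1 ∧ A.1 ⊆ x.2) ((2 * r).choose 3)
    (fun x hx => by
      simp only [I, Finset.mem_filter, Finset.mem_univ, true_and] at hx
      exact choose_le_card_between hx.1 hx.2.1 hx.2.2)
    (card_mul_exp_neg_lt_one Fintype.card_pos hI (mul_le_choose_two_mul_three hr hp))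
  refine ⟨e, fun J D h1 h2 h3 a => ?_⟩
  obtain ⟨c, hc, hc'⟩ := he (J, D) (by simp [I, h1, h2, h3]) a
  exact ⟨c, hc, by simpa using hc'⟩

/-! ### Maximal cliques in an expansion. -/

theorem SimpleGraph.maximal_isClique_iff {V : Type*} {G : SimpleGraph V} {s : Set V} :
    Maximal G.IsClique s ↔ G.IsClique s ∧ ∀ v ∉ s, ∃ u ∈ s, ¬ G.Adj v u := by
  constructor
  · refine fun h => ⟨h.prop, fun v hv => ?_⟩
    by_contra! hcon
    exact hv (h.le_of_ge (h.prop.insert fun u hu _ => hcon u hu) (Set.subset_insert v s)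
      (Set.mem_insert v s))
  · rintro ⟨hs, h⟩
    refine ⟨hs, fun t ht hst v hv => ?_⟩
    by_contra hvs
    obtain ⟨u, hu, huv⟩ := h v hvs
    exact huv (ht hv (hst hu) (by rintro rfl; exact hvs hu))

namespace CliqueExpansion

variable {V : Type*} {G : SimpleGraph V}

/-- The clique formed by a vertex `c` of the base clique and its neighbors in the petal `p`. -/
def petalStar {n r : ℕ} (p : PetalIndex G n r) (c : {c : V // c ∈ p.C}) :
    Set (ExpansionVertex G n r) :=
  insert (Sum.inl c.1) ((fun j => Sum.inr (p, j)) '' ((p.bij c).1 : Set (Fin n)))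

theorem ncard_petalStar {n r : ℕ} (p : PetalIndex G n r) (c : {c : V // c ∈ p.C}) :
    (petalStar p c).ncard = r + 1 := by
  rw [petalStar, Set.ncard_insert_of_notMem (by simp) ((Finset.finite_toSet _).image _),
    Set.ncard_image_of_injective _ (fun i j h => by simpa using h), Set.ncard_coe_finset,
    (p.bij c).2]

/-- Distinct `r`-sets do not contain one another, so any other vertex of `p.C` misses a petal vertex
of the star; the remaining vertices of the petal miss `c`. -/
theorem maximal_petalStar {n r : ℕ} (hr : 0 < r) (p : PetalIndex G n r)
    (c : {c : V // c ∈ p.C}) : Maximal (universalExpansion G n r).IsClique (petalStar p c) := by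
  obtain ⟨j₀, hj₀⟩ : (p.bij c).1.Nonempty := Finset.card_pos.1 (by rw [(p.bij c).2]; exact hr)
  rw [SimpleGraph.maximal_isClique_iff]
  refine ⟨?_, ?_⟩
  · rw [petalStar, SimpleGraph.isClique_insert]
    refine ⟨?_, ?_⟩
    · rintro _ ⟨i, -, rfl⟩ _ ⟨j, -, rfl⟩ hne
      exact ⟨rfl, fun h => hne (by rw [h])⟩
    · rintro _ ⟨i, hi, rfl⟩ -
      exact ⟨c.2, hi⟩
  · rintro (u | ⟨q, j⟩) hv
    · by_cases hu : u ∈ p.C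
      · have hne : (p.bij ⟨u, hu⟩).1 ≠ (p.bij c).1 := by
          intro h
          have : (⟨u, hu⟩ : {c : V // c ∈ p.C}) = c := p.bij.injective (Subtype.ext h)
          exact hv (Or.inl (by rw [← this]))
        have hns : ¬ (p.bij c).1 ⊆ (p.bij ⟨u, hu⟩).1 := fun h =>
          hne (Finset.eq_of_subset_of_card_le h (by rw [(p.bij _).2, (p.bij _).2])).symm
        obtain ⟨j, hj, hj'⟩ := Finset.not_subset.1 hns
        exact ⟨Sum.inr (p, j), Or.inr ⟨j, hj, rfl⟩, fun ⟨_, h⟩ => hj' h⟩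
      · exact ⟨Sum.inr (p, j₀), Or.inr ⟨j₀, hj₀, rfl⟩, fun ⟨h, _⟩ => hu h⟩
    · by_cases hq : q = p
      · subst hq
        exact ⟨Sum.inl c.1, Or.inl rfl, fun ⟨_, h⟩ => hv (Or.inr ⟨j, h, rfl⟩)⟩
      · exact ⟨Sum.inr (p, j₀), Or.inr ⟨j₀, hj₀, rfl⟩, fun h => hq h.1⟩

/-- A maximal clique that is too large for the petals remains maximal in the expansion. -/
theorem maximal_image_inl {n r : ℕ} {s : Set V} (hs : Maximal G.IsClique s)
    (hcard : n.choose r < s.ncard) :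
    Maximal (universalExpansion G n r).IsClique (baseEmbedding G n r '' s) := by
  rw [SimpleGraph.maximal_isClique_iff] at hs ⊢
  refine ⟨?_, ?_⟩
  · rintro _ ⟨u, hu, rfl⟩ _ ⟨v, hv, rfl⟩ hne
    exact hs.1 hu hv fun h => hne (by rw [h])
  · rintro (u | ⟨q, j⟩) hv
    · obtain ⟨w, hw, hwu⟩ := hs.2 u fun h => hv ⟨u, h, rfl⟩
      exact ⟨_, ⟨w, hw, rfl⟩, hwu⟩
    -- The base neighbors of a petal vertex lie in `q.C`, which is smaller than `s`.
    · have : ¬ s ⊆ (q.C : Set V) := by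
        intro h
        have := Set.ncard_le_ncard h q.C.finite_toSet
        rw [Set.ncard_coe_finset, q.isNClique.card_eq] at this
        omega
      obtain ⟨w, hw, hwq⟩ := Set.not_subset.1 this
      exact ⟨_, ⟨w, hw, rfl⟩, fun ⟨h, _⟩ => hwq h⟩

/-! ### Gaining one color in one expansion. -/

/-- Exactly `p` colors appear on `C`, all equally often. -/
def IsBalanced {W α : Type*} [DecidableEq α] (ψ : W → α) (C : Finset W) (p : ℕ) : Prop :=
  (C.image ψ).card = p ∧ ∀ a ∈ C.image ψ, p * (C.filter fun v => ψ v = a).card = C.card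

theorem isBalanced_of_card_filter {W α : Type*} [DecidableEq α] {ψ : W → α} {C : Finset W}
    {A : Finset α} {m : ℕ} (hm : 0 < m) (hA : ∀ v ∈ C, ψ v ∈ A)
    (h : ∀ a ∈ A, (C.filter fun v => ψ v = a).card = m) :
    IsBalanced ψ C A.card ∧ C.card = A.card * m := by
  have himg : C.image ψ = A := by
    ext a
    constructor
    · intro ha
      obtain ⟨v, hv, rfl⟩ := Finset.mem_image.1 ha
      exact hA v hv
    · intro ha
      obtain ⟨v, hv⟩ := Finset.card_pos.1 ((h a ha).symm ▸ hm)
      rw [Finset.mem_filter] at hv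
      exact Finset.mem_image.2 ⟨v, hv.1, hv.2⟩
  have hcard : C.card = A.card * m := by
    rw [Finset.card_eq_sum_card_fiberwise hA, Finset.sum_congr rfl h, Finset.sum_const,
      smul_eq_mul]
  refine ⟨⟨by rw [himg], fun a ha => ?_⟩, hcard⟩
  rw [h a (himg ▸ ha), hcard]

/-- A family of vertices of `p.C`, all adjacent to the petal vertices in `J`, forms a clique
together with `J`. -/
theorem isClique_disjSum {n r : ℕ} (p : PetalIndex G n r) (S : Finset V) (J : Finset (Fin n))
    (hS : ∀ c ∈ S, ∃ h : c ∈ p.C, J ⊆ (p.bij ⟨c, h⟩).1) :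
    (universalExpansion G n r).IsClique
      (S.disjSum (J.map (Function.Embedding.sectR p (Fin n))) : Set _) := by
  rintro (u | ⟨q, i⟩) hu (v | ⟨q', j⟩) hv hne
  · simp only [Finset.mem_coe, Finset.inl_mem_disjSum] at hu hv
    exact p.isNClique.isClique (hS u hu).1 (hS v hv).1 fun h => hne (by rw [h])
  · simp only [Finset.mem_coe, Finset.inl_mem_disjSum, Finset.inr_mem_disjSum, Finset.mem_map,
      Function.Embedding.sectR_apply, Prod.mk.injEq] at hu hv
    obtain ⟨j, hj, rfl, rfl⟩ := hv
    exact ⟨(hS u hu).1, (hS u hu).2 hj⟩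
  · simp only [Finset.mem_coe, Finset.inl_mem_disjSum, Finset.inr_mem_disjSum, Finset.mem_map,
      Function.Embedding.sectR_apply, Prod.mk.injEq] at hu hv
    obtain ⟨j, hj, rfl, rfl⟩ := hu
    exact ⟨(hS v hv).1, (hS v hv).2 hj⟩
  · simp only [Finset.mem_coe, Finset.inr_mem_disjSum, Finset.mem_map,
      Function.Embedding.sectR_apply, Prod.mk.injEq] at hu hv
    obtain ⟨i, -, rfl, rfl⟩ := hu
    obtain ⟨j, -, rfl, rfl⟩ := hv
    exact ⟨rfl, fun h => hne (by rw [h])⟩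

/-- If fewer than `m` such `c` existed, deleting one point of `e c \ J` for each would leave a set
`D` that contains none of their sets, yet is large enough for `h` to apply. -/
theorem le_card_filter_superset {C P : Type*} [Fintype C] [DecidableEq P] {n r m : ℕ} (f : C → P)
    (e : C ≃ {A : Finset (Fin n) // A.card = r}) {J : Finset (Fin n)} (hJ : J.card < r) (a : P)
    (h : ∀ D, J ⊆ D → n ≤ D.card + m → ∃ c, f c = a ∧ J ⊆ (e c).1 ∧ (e c).1 ⊆ D) :
    m ≤ (Finset.univ.filter fun c => f c = a ∧ J ⊆ (e c).1).card := by
  classical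
  by_contra! hlt
  have hy : ∀ c, ∃ y ∈ (e c).1, y ∉ J := by
    intro c
    apply Finset.exists_mem_notMem_of_card_lt_card
    rw [(e c).2]
    exact hJ
  choose y hy hyJ using hy
  set Y := (Finset.univ.filter fun c => f c = a ∧ J ⊆ (e c).1).image y with hY
  have hYm : Y.card ≤ m := Finset.card_image_le.trans hlt.le
  obtain ⟨c, hc, hJc, hcD⟩ := h Yᶜ (fun j hj => by
      rw [Finset.mem_compl, hY, Finset.mem_image]
      rintro ⟨c, -, rfl⟩
      exact hyJ c hj) (by
      rw [Finset.card_compl, Fintype.card_fin]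
      omega)
  exact Finset.mem_compl.1 (hcD (hy c))
    (Finset.mem_image.2 ⟨c, by simp [hc, hJc], rfl⟩)

/-- A balanced clique with `p` colors gives one with `p + 1` colors in the expansion, as soon as
no petal star is monochromatic. -/
theorem exists_balanced_clique_succ {r k p : ℕ} (ψ : ExpansionVertex G (r ^ 2) r → Fin (k + 1))
    (hψ : ∀ q c, ¬ ∃ a, ∀ v ∈ petalStar (G := G) (n := r ^ 2) (r := r) q c, ψ v = a)
    (hr : 6 ≤ r) (hp0 : 0 < p) (hpk : p ≤ k) (hkr : 3 * k ≤ r) (hk2 : 2 * (k + 1) ≤ r)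
    (hdvd : p + 1 ∣ r)
    {C : Finset V} (hC : G.IsNClique ((r ^ 2).choose r) C)
    (hbal : IsBalanced (fun v => ψ (Sum.inl v)) C p) :
    ∃ C' : Finset (ExpansionVertex G (r ^ 2) r),
      (universalExpansion G (r ^ 2) r).IsNClique r C' ∧ IsBalanced ψ C' (p + 1) := by
  classical
  obtain ⟨m, hm⟩ := hdvd
  have hm0 : 0 < m := Nat.pos_of_ne_zero (by rintro rfl; omega)
  -- From `p ≥ 1`. It gives `m + 3 ≤ r` and, with `hrr`, `2 * r + m ≤ r ^ 2 - m`: the interval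
  -- conditions for `|J| = m` and `|D| ≥ r ^ 2 - m`.
  have h2m : 2 * m ≤ r := by nlinarith
  have hrr : 6 * r ≤ r ^ 2 := by nlinarith
  set A := C.image fun v => ψ (Sum.inl v)
  have hAp : A.card = p := hbal.1
  obtain ⟨a₀, ha₀⟩ := Finset.card_pos.1 (hAp.symm ▸ hp0)
  have : Nonempty A := ⟨⟨a₀, ha₀⟩⟩
  let f : {c // c ∈ C} → A := fun c => ⟨ψ (Sum.inl c.1), Finset.mem_image_of_mem _ c.2⟩
  have hf : ∀ a, Fintype.card {c // f c = a} = C.card / p := by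
    intro a
    rw [← hbal.2 a.1 a.2, Nat.mul_div_cancel_left _ hp0, Fintype.card_subtype]
    rw [← Finset.card_map (Function.Embedding.subtype _)]
    congr 1
    ext v
    simp [f, Subtype.ext_iff, and_comm]
  obtain ⟨e, he⟩ := exists_equiv_forall_between f _ hf
    (by rw [Fintype.card_coe, hC.card_eq]) hr (by rw [Fintype.card_coe, hAp]; omega)
  let q : PetalIndex G (r ^ 2) r := ⟨C, hC, e⟩
  let X : Fin (k + 1) → Finset (Fin (r ^ 2)) := fun a =>
    Finset.univ.filter fun j => ψ (Sum.inr (q, j)) = a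
  have hX : ∀ a ∈ A, (X a).card < 2 * r := by
    intro a ha
    by_contra! hle
    obtain ⟨c, hc, -, hcX⟩ := he ∅ (X a) (Finset.empty_subset _) (by simpa using hle)
      (by simp; omega) ⟨a, ha⟩
    refine hψ q c ⟨a, ?_⟩
    rintro v (rfl | ⟨j, hj, rfl⟩)
    · exact congrArg Subtype.val hc
    · exact (Finset.mem_filter.1 (hcX hj)).2
  obtain ⟨b, -, hb⟩ : ∃ b ∈ (Finset.univ : Finset (Fin (k + 1))), 2 * r ≤ (X b).card := by
    apply Finset.exists_le_card_fiber_of_mul_le_card_of_maps_to (fun _ _ => Finset.mem_univ _)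
    · exact Finset.univ_nonempty
    · simp only [Finset.card_univ, Fintype.card_fin]
      calc (k + 1) * (2 * r) = 2 * (k + 1) * r := by ring
        _ ≤ r * r := Nat.mul_le_mul_right _ hk2
        _ = r ^ 2 := (sq r).symm
  have hbA : b ∉ A := fun h => (hX b h).not_ge hb
  obtain ⟨J, hJX, hJm⟩ := Finset.exists_subset_card_eq (show m ≤ (X b).card by omega)
  have hS : ∀ a : A, ∃ S ⊆ Finset.univ.filter fun c => f c = a ∧ J ⊆ (e c).1, S.card = m := by
    intro a
    apply Finset.exists_subset_card_eq
    apply le_card_filter_superset f e (by omega)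
    intro D hJD hD
    exact he J D hJD (by omega) (by omega) a
  choose S hSsub hSm using hS
  have hSf : ∀ a, ∀ c ∈ S a, ψ (Sum.inl c.1) = a.1 ∧ J ⊆ (e c).1 := by
    intro a c hc
    have := (Finset.mem_filter.1 (hSsub a hc)).2
    exact ⟨congrArg Subtype.val this.1, this.2⟩
  let T : Finset V := (Finset.univ.biUnion S).map (Function.Embedding.subtype _)
  have hT : ∀ v, v ∈ T ↔ ∃ h : v ∈ C, ∃ a, (⟨v, h⟩ : {c // c ∈ C}) ∈ S a := by
    intro v
    simp [T]
  let C' : Finset (ExpansionVertex G (r ^ 2) r) :=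
    T.disjSum (J.map (Function.Embedding.sectR q _))
  have hTA : ∀ v ∈ T, ψ (Sum.inl v) ∈ A := fun v hv =>
    Finset.mem_image_of_mem _ ((hT v).1 hv).1
  have hJb : ∀ j ∈ J, ψ (Sum.inr (q, j)) = b := fun j hj => (Finset.mem_filter.1 (hJX hj)).2
  have hmem : ∀ v ∈ C', ψ v ∈ insert b A := by
    rintro (v | ⟨q', j⟩) hv
    · exact Finset.mem_insert_of_mem (hTA v (Finset.inl_mem_disjSum.1 hv))
    · obtain ⟨j, hj, h⟩ := Finset.mem_map.1 (Finset.inr_mem_disjSum.1 hv)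
      rw [← h]
      exact Finset.mem_insert.2 (Or.inl (hJb j hj))
  have hclass : ∀ a ∈ insert b A, (C'.filter fun v => ψ v = a).card = m := by
    intro a ha
    rcases Finset.mem_insert.1 ha with rfl | ha
    · have : C'.filter (fun v => ψ v = a) =
          J.map ((Function.Embedding.sectR q _).trans Function.Embedding.inr) := by
        ext v
        rcases v with v | ⟨q', j⟩
        · simp only [C', Finset.mem_filter, Finset.inl_mem_disjSum, Finset.mem_map,
            Function.Embedding.trans_apply, Function.Embedding.inr_apply,
            reduceCtorEq, and_false, exists_false, iff_false, not_and]
          exact fun hv h => hbA (h ▸ hTA v hv)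
        · simp only [C', Finset.mem_filter, Finset.inr_mem_disjSum, Finset.mem_map,
            Function.Embedding.trans_apply, Function.Embedding.inr_apply,
            Function.Embedding.sectR_apply, Sum.inr.injEq, and_iff_left_iff_imp]
          rintro ⟨j, hj, h⟩
          rw [← h]
          exact hJb j hj
      rw [this, Finset.card_map, hJm]
    · have : C'.filter (fun v => ψ v = a) = (S ⟨a, ha⟩).map
          ((Function.Embedding.subtype _).trans Function.Embedding.inl) := by
        ext v
        rcases v with v | ⟨q', j⟩
        · simp only [C', Finset.mem_filter, Finset.inl_mem_disjSum, Finset.mem_map,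
            Function.Embedding.trans_apply, Function.Embedding.inl_apply, Sum.inl.injEq]
          constructor
          · rintro ⟨hv, h⟩
            obtain ⟨hvC, a', ha'⟩ := (hT v).1 hv
            have : a' = ⟨a, ha⟩ := Subtype.ext ((hSf a' _ ha').1.symm.trans h)
            exact ⟨⟨v, hvC⟩, this ▸ ha', rfl⟩
          · rintro ⟨c, hc, rfl⟩
            exact ⟨(hT _).2 ⟨c.2, _, hc⟩, (hSf _ c hc).1⟩
        · simp only [C', Finset.mem_filter, Finset.inr_mem_disjSum, Finset.mem_map,
            Function.Embedding.sectR_apply, Function.Embedding.trans_apply,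
            Function.Embedding.inl_apply, reduceCtorEq, and_false, exists_false, iff_false, not_and]
          rintro ⟨j, hj, h⟩ hja
          rw [← h] at hja
          exact hbA (by rw [← hJb j hj, hja]; exact ha)
      rw [this, Finset.card_map, hSm]
  obtain ⟨h1, h2⟩ := isBalanced_of_card_filter hm0 hmem hclass
  rw [Finset.card_insert_of_notMem hbA, hAp] at h1 h2
  refine ⟨C', ⟨?_, h2.trans hm.symm⟩, h1⟩
  apply isClique_disjSum q T J
  intro c hc
  obtain ⟨h, a, ha⟩ := (hT c).1 hc
  exact ⟨h, (hSf a _ ha).2⟩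

end CliqueExpansion

/-! ### The sizes `n_i` and the tower of expansions. -/

namespace CliqueExpansion

theorem size_pred_le (k i : ℕ) (hi : i < k) : size k (i + 1) ≤ size k i := by
  rw [size_pred k i hi]
  set r := size k (i + 1)
  rcases Nat.eq_zero_or_pos r with h | h
  · omega
  have hrr : r ≤ r ^ 2 := Nat.le_self_pow two_ne_zero r
  rcases hrr.eq_or_lt with h1 | h1
  · have : r = 1 := by nlinarith
    rw [this]
    simp
  have hr1 : 1 < r := by
    by_contra hc
    have : r = 1 := by omega
    rw [this] at h1
    omega
  calc r ≤ r ^ 2 := hrr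
    _ = (r ^ 2).choose 1 := (Nat.choose_one_right _).symm
    _ ≤ (r ^ 2).choose r := choose_le_choose_of_le_half hr1.le (by nlinarith)

theorem size_antitone (k : ℕ) {i j : ℕ} (hij : i ≤ j) (hj : j ≤ k) : size k j ≤ size k i := by
  induction j, hij using Nat.le_induction with
  | base => exact le_rfl
  | succ j _ ih => exact (size_pred_le k j hj).trans (ih (by omega))

theorem size_pos (k i : ℕ) (hi : i ≤ k) : 0 < size k i :=
  (Nat.factorial_pos _).trans_le ((size_self k).symm.le.trans (size_antitone k hi le_rfl))

/-- The quotient is `(r ^ 2 - 1).choose (r - 1)`. Hence `(k + 1)!` divides every `n_i`, so the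
balanced class sizes are integers. -/
theorem dvd_choose_sq {r : ℕ} (hr : 0 < r) : r ∣ (r ^ 2).choose r := by
  obtain ⟨r, rfl⟩ := Nat.exists_eq_add_one_of_ne_zero hr.ne'
  obtain ⟨t, ht⟩ : ∃ t, (r + 1) ^ 2 = t + 1 := ⟨(r + 1) ^ 2 - 1, by
    have : 0 < (r + 1) ^ 2 := by positivity
    omega⟩
  have h := Nat.add_one_mul_choose_eq t r
  rw [← ht] at h
  refine ⟨t.choose r, Nat.eq_of_mul_eq_mul_right (Nat.succ_pos r) ?_⟩
  rw [Nat.succ_eq_add_one, ← h]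
  ring

theorem factorial_dvd_size (k i : ℕ) (hi : i ≤ k) : (k + 1).factorial ∣ size k i := by
  induction hi using Nat.decreasingInduction with
  | self => rw [size_self]
  | of_succ j hj ih => exact ih.trans (size_pred k j hj ▸ dvd_choose_sq (size_pos k _ hj))

theorem incl_refl (k i : ℕ) (v : Vert k i) : incl k (le_refl i) v = v := by
  simp [incl]

theorem incl_succ (k : ℕ) {i j : ℕ} (h : i ≤ j) :
    incl k (h.trans (Nat.le_succ j)) = (stepEmbedding k j).comp (incl k h) := by
  unfold incl
  rw [Nat.leRec_succ]

/-- `incl` grows at the top of the tower, whereas the main induction needs its bottom step split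
off. -/
theorem incl_step (k : ℕ) {i j : ℕ} (h : i + 1 ≤ j) (v : Vert k i) :
    incl k ((Nat.le_succ i).trans h) v = incl k h (stepEmbedding k i v) := by
  induction j, h using Nat.le_induction with
  | base =>
    rw [incl_refl, incl_succ k (le_refl i)]
    exact congrArg (stepEmbedding k i) (incl_refl k i v)
  | succ j hj ih =>
    rw [incl_succ k ((Nat.le_succ i).trans hj), incl_succ k hj]
    exact congrArg (stepEmbedding k j) ih

/-- A maximal clique of `H_i` with more than `n_i` vertices is maximal in every later `H_j`. -/
theorem maximal_image_incl {k i j : ℕ} (hij : i ≤ j) (hj : j ≤ k) {s : Set (Vert k i)}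
    (hs : Maximal (H k i).IsClique s) (hcard : size k i < s.ncard) :
    Maximal (H k j).IsClique (incl k hij '' s) := by
  induction j, hij using Nat.le_induction with
  | base =>
    have : incl k (le_refl i) '' s = s := by
      simp [incl_refl]
    rwa [this]
  | succ j hij ih =>
    have h := maximal_image_inl (n := size k (j + 1) ^ 2) (r := size k (j + 1))
      (ih (by omega)) (by
        rw [← size_pred k j hj, Set.ncard_image_of_injective _ (incl k hij).injective]
        exact (size_antitone k hij (by omega)).trans_lt hcard)
    rw [Set.image_image] at h
    rw [incl_succ k hij]
    exact h

theorem not_monochromatic_of_maximal {k i : ℕ} (hi : i ≤ k) {φ : Vert k k → Fin (k + 1)}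
    (hφ : (Gk k).IsCliqueColoring φ) {s : Set (Vert k i)} (hs : Maximal (H k i).IsClique s)
    (hcard : size k i < s.ncard) : ¬ ∃ a, ∀ v ∈ s, φ (incl k hi v) = a := by
  rintro ⟨a, ha⟩
  refine hφ _ (maximal_image_incl hi le_rfl hs hcard) ?_ ⟨a, ?_⟩
  · have hpos := size_pos k i hi
    exact ((Set.one_lt_ncard_iff_nontrivial_and_finite.1 (by omega)).1).image (incl k hi).injective
  · rintro _ ⟨v, hv, rfl⟩
    exact ha v hv

theorem two_mul_le_factorial {k : ℕ} (hk : 2 ≤ k) : 2 * (k + 1) ≤ (k + 1).factorial := by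
  rw [Nat.factorial_succ, mul_comm]
  exact Nat.mul_le_mul_left _ (hk.trans (Nat.self_le_factorial k))

theorem three_mul_le_factorial {k : ℕ} (hk : 2 ≤ k) : 3 * k ≤ (k + 1).factorial := by
  rw [Nat.factorial_succ]
  exact Nat.mul_le_mul (by omega) (Nat.self_le_factorial k)

theorem exists_isUniformClique {k : ℕ} (hk : 2 ≤ k) {φ : Vert k k → Fin (k + 1)}
    (hφ : (Gk k).IsCliqueColoring φ) (i : ℕ) (hi : i ≤ k) :
    ∃ C : Finset (Vert k i), IsUniformClique hi φ C := by
  suffices h : ∃ C : Finset (Vert k i), (H k i).IsNClique (size k i) C ∧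
      IsBalanced (fun v => φ (incl k hi v)) C (i + 1) by
    obtain ⟨C, hC, hbal⟩ := h
    exact ⟨C, hC, hbal.1, fun a ha => (hbal.2 a ha).trans hC.card_eq⟩
  induction i with
  | zero =>
    obtain ⟨b, -, hb⟩ : ∃ b ∈ (Finset.univ : Finset (Fin (k + 1))), size k 0 ≤
        ((Finset.univ : Finset (Fin ((k + 1) * size k 0))).filter
          fun v => φ (incl k hi v) = b).card := by
      apply Finset.exists_le_card_fiber_of_mul_le_card_of_maps_to (fun _ _ => Finset.mem_univ _)
      · exact Finset.univ_nonempty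
      · exact (Nat.mul_le_mul_right _ (Finset.card_fin (k + 1)).le).trans
          (Finset.card_fin ((k + 1) * size k 0)).ge
    obtain ⟨C, hCsub, hC⟩ := Finset.exists_subset_card_eq hb
    have hCb : ∀ v ∈ C, φ (incl k hi v) = b := fun v hv => (Finset.mem_filter.1 (hCsub hv)).2
    refine ⟨C, ⟨fun u _ v _ h => h, hC⟩, ?_⟩
    have h := isBalanced_of_card_filter (A := {b}) (ψ := fun v : Vert k 0 => φ (incl k hi v))
      (C := C) (size_pos k 0 hi) (fun v hv => Finset.mem_singleton.2 (hCb v hv)) (by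
        intro a ha
        rw [Finset.mem_singleton.1 ha, Finset.filter_true_of_mem hCb, hC])
    simpa using h.1
  | succ i ih =>
    obtain ⟨C, hC, hbal⟩ := ih (by omega)
    rw [size_pred k i hi] at hC
    have hle : (k + 1).factorial ≤ size k (i + 1) :=
      (size_self k).symm.le.trans (size_antitone k hi le_rfl)
    have h3 := three_mul_le_factorial hk
    have h2 := two_mul_le_factorial hk
    refine exists_balanced_clique_succ (fun v => φ (incl k hi v)) (fun q c => ?_) (by omega)
      (Nat.succ_pos i) hi (by omega) (by omega) ?_ hC ?_
    · refine not_monochromatic_of_maximal hi hφ (maximal_petalStar (size_pos k _ hi) q c) ?_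
      -- A star has `n_{i+1} + 1` vertices, just enough to remain maximal.
      exact (Nat.lt_succ_self _).trans_eq (ncard_petalStar q c).symm
    · exact (Nat.dvd_factorial (by omega) (by omega)).trans (factorial_dvd_size k _ hi)
    · have : (fun v => φ (incl k (show i ≤ k by omega) v)) =
          fun v => φ (incl k hi (stepEmbedding k i v)) := by
        funext v
        rw [← incl_step]
      rw [this] at hbal
      exact hbal

theorem surjective_of_isCliqueColoring {k : ℕ} (hk : 2 ≤ k) {φ : Vert k k → Fin (k + 1)}
    (hφ : (Gk k).IsCliqueColoring φ) : Function.Surjective φ := by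
  obtain ⟨C, hC⟩ := exists_isUniformClique hk hφ k le_rfl
  intro a
  have h : C.image (fun v => φ (incl k le_rfl v)) = Finset.univ :=
    Finset.eq_univ_of_card _ (by rw [hC.card_colors, Fintype.card_fin])
  obtain ⟨v, -, hv⟩ := Finset.mem_image.1 (h.symm ▸ Finset.mem_univ a)
  exact ⟨_, hv⟩

end CliqueExpansion

/-! ### The lower bound on the clique-chromatic number. -/

theorem SimpleGraph.IsCliqueColoring.comp_injective {V α β : Type*} {G : SimpleGraph V}
    {φ : V → α} (h : G.IsCliqueColoring φ) {f : α → β} (hf : Function.Injective f) :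
    G.IsCliqueColoring (f ∘ φ) := by
  rintro s hs hnt ⟨b, hb⟩
  obtain ⟨v, hv⟩ := hnt.nonempty
  exact h s hs hnt ⟨φ v, fun w hw => hf ((hb w hw).trans (hb v hv).symm)⟩

theorem proposition7 (k : ℕ) (hk : 2 ≤ k) :
    (∀ φ : CliqueExpansion.Vert k k → Fin (k + 1), (CliqueExpansion.Gk k).IsCliqueColoring φ →
      (∀ (i : ℕ) (hi : i ≤ k), ∃ C : Finset (CliqueExpansion.Vert k i),
        CliqueExpansion.IsUniformClique hi φ C) ∧
      Function.Surjective φ) ∧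
    ((k + 1 : ℕ) : ℕ∞) ≤ (CliqueExpansion.Gk k).cliqueChromaticNumber := by
  refine ⟨fun φ hφ => ⟨CliqueExpansion.exists_isUniformClique hk hφ,
    CliqueExpansion.surjective_of_isCliqueColoring hk hφ⟩, ?_⟩
  refine le_iInf₂ fun m hm => ?_
  obtain ⟨φ, hφ⟩ := hm
  by_contra! hlt
  have hmk : m < k + 1 := by exact_mod_cast hlt
  -- Read as a `(k + 1)`-coloring, the coloring with `m` colors never takes the value `m`.
  obtain ⟨v, hv⟩ := CliqueExpansion.surjective_of_isCliqueColoring hk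
    (hφ.comp_injective (Fin.castLE_injective hmk.le)) ⟨m, hmk⟩
  have := congrArg Fin.val hv
  simp only [Function.comp_apply, Fin.val_castLE] at this
  have := (φ v).isLt
  omega
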